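/- Let $d,p\ge 1$ be integers and let $\psi:[0,\infty)\to(0,\infty)$ be continuous, and differentiable on $(0,\infty)$ with completely monotone derivative (that is, $\psi'$ is infinitely differentiable on $(0,\infty)$ and $(-1)^n(\psi')^{(n)}(t)\ge 0$ for all integers $n\ge 0$ and all $t>0$). For $r,\nu>0$ let $$\mathcal M(\mathbf h;r,\nu)=\frac{2^{1-\nu}}{\Gamma(\nu)}\,(r\|\mathbf h\|)^{\nu}K_\nu(r\|\mathbf h\|),\quad \mathbf h\in\mathbb R^d\setminus\{0\},\qquad \mathcal M(\mathbf 0;r,\nu)=1,$$ be the Matérn correlation function on $\mathbb R^d$, where $K_\nu$ is the modified Bessel function of the second kind of order $\nu$, i.e. $K_\nu(x)=\int_0^\infty e^{-x\cosh t}\cosh(\nu t)\,dt$ for $x>0$. Let $\sigma_i\in\mathbb R$, $r_i>0$, $\nu_i>0$ for $i=1,\dots,p$, let $\beta=[\beta_{ij}]_{i,j=1}^p$ be a correlation matrix (real, symmetric, positive semidefinite, with unit diagonal), and set, for $i,j=1,\dots,p$, $$r_{ij}=\Big(\frac{r_i^2+r_j^2}{2}\Big)^{1/2},\qquad \nu_{ij}=\frac{\nu_i+\nu_j}{2},\qquad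 \rho_{ij}=\beta_{ij}\,\frac{\Gamma(\nu_{ij})}{\Gamma(\nu_i)^{1/2}\Gamma(\nu_j)^{1/2}}\,\frac{r_i^{\nu_i}r_j^{\nu_j}}{r_{ij}^{2\nu_{ij}}}.$$ Then the multivariate Gneiting–Matérn model $\mathbf C=[C_{ij}]_{i,j=1}^p$, $$C_{ij}(\mathbf h,u)=\frac{\sigma_i\sigma_j}{\psi(u^2)^{d/2}}\,\rho_{ij}\,\mathcal M\!\left(\frac{\mathbf h}{\psi(u^2)^{1/2}};r_{ij},\nu_{ij}\right),\qquad(\mathbf h,u)\in\mathbb R^d\times\mathbb R,$$ is a valid matrix-valued space-time covariance function on $\mathbb R^d\times\mathbb R$: for every $n\in\mathbb N$ and all points $(\mathbf s_1,t_1),\dots,(\mathbf s_n,t_n)\in\mathbb R^d\times\mathbb R$, the $np\times np$ matrix with $p\times p$ blocks $\mathbf C(\mathbf s_\alpha-\mathbf s_\beta,t_\alpha-t_\beta)$, $\alpha,\beta=1,\dots,n$, is symmetric and positive semidefinite. -/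

import Mathlib

open scoped ContDiff

noncomputable section

namespace GneitingMatern

/-- `f` is completely monotone on the positive half-line `(0, ∞)`: it is infinitely
differentiable there and `(-1)^n f^{(n)}(t) ≥ 0` for all `n` and all `t > 0`. -/
structure CompletelyMonotone (f : ℝ → ℝ) : Prop where
  contDiffOn : ContDiffOn ℝ ∞ f (Set.Ioi 0)
  alternating : ∀ (n : ℕ) (t : ℝ), 0 < t → 0 ≤ (-1 : ℝ) ^ n * iteratedDeriv n f t

/-- `ψ` is a (strictly) positive continuous function on `[0, ∞)` whose derivative is completely
monotone on `(0, ∞)`. Only the values of `ψ` on `[0, ∞)` matter; no derivative at `0` is required,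
so that for instance `ψ t = (α * t ^ a + 1) ^ b` with `0 < a ≤ 1`, `0 ≤ b ≤ 1` is allowed. -/
structure PositiveBernstein (ψ : ℝ → ℝ) : Prop where
  pos : ∀ t : ℝ, 0 ≤ t → 0 < ψ t
  continuousOn : ContinuousOn ψ (Set.Ici 0)
  differentiableOn : DifferentiableOn ℝ ψ (Set.Ioi 0)
  deriv_completelyMonotone : CompletelyMonotone (deriv ψ)

/-- The modified Bessel function of the second kind of real order `ν`, at a real argument `x > 0`:
`K_ν(x) = ∫_0^∞ exp(-x cosh t) cosh(ν t) dt`. -/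
def besselK (ν x : ℝ) : ℝ :=
  ∫ t in Set.Ioi (0 : ℝ), Real.exp (-x * Real.cosh t) * Real.cosh (ν * t)

/-- The Matérn correlation function `M(h; r, ν) = 2^{1-ν} / Γ(ν) (r‖h‖)^ν K_ν(r‖h‖)` on `ℝ^d`
with scale `r > 0` and smoothness `ν > 0`. As `K_ν` is singular at `0`, the formula is read at
`h = 0` as its limit for `h → 0`, which is `1`. -/
def matern {d : ℕ} (h : EuclideanSpace ℝ (Fin d)) (r ν : ℝ) : ℝ :=
  if h = 0 then 1
  else (2 : ℝ) ^ (1 - ν) / Real.Gamma ν * (r * ‖h‖) ^ ν * besselK ν (r * ‖h‖)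

/-- The matrix-valued function with entries
`C_ij(h,u) = σ_i σ_j / ψ(u²)^{d/2} * ρ_ij * M(h / ψ(u²)^{1/2}; r_ij, ν_ij)` on `ℝ^d × ℝ`. -/
def gneitingMatern {d p : ℕ} (ψ : ℝ → ℝ) (σ : Fin p → ℝ) (ρ r ν : Fin p → Fin p → ℝ)
    (h : EuclideanSpace ℝ (Fin d)) (u : ℝ) : Matrix (Fin p) (Fin p) ℝ :=
  Matrix.of fun i j =>
    σ i * σ j / ψ (u ^ 2) ^ ((d : ℝ) / 2) * ρ i j *
      matern ((ψ (u ^ 2) ^ (1 / 2 : ℝ))⁻¹ • h) (r i j) (ν i j)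

/-- A correlation matrix: real symmetric positive semidefinite with unit diagonal. -/
def IsCorrelationMatrix {p : ℕ} (β : Matrix (Fin p) (Fin p) ℝ) : Prop :=
  β.PosSemidef ∧ ∀ i, β i i = 1

/-- The matrix-valued function `C` of the space-time lag is a valid (stationary) covariance
function on `ℝ^d × ℝ`: for all finitely many space-time points `(s_1, t_1), …, (s_n, t_n)`, the
`np × np` matrix with `p × p` blocks `C(s_a - s_b, t_a - t_b)` is symmetric and positive
semidefinite. -/
def IsValidCovariance {d p : ℕ}
    (C : EuclideanSpace ℝ (Fin d) → ℝ → Matrix (Fin p) (Fin p) ℝ) : Prop :=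
  ∀ (n : ℕ) (s : Fin n → EuclideanSpace ℝ (Fin d)) (t : Fin n → ℝ),
    (Matrix.of fun a b : Fin n × Fin p =>
      C (s a.1 - s b.1) (t a.1 - t b.1) a.2 b.2).PosSemidef

end GneitingMatern

end

/-! The Matérn function is a Gaussian scale mixture: `Gamma_mul_matern` writes Γ(ν)M(h;r,ν) as
r^{2ν} ∫ y^{ν-1} e^{-r²y} e^{-‖h‖²/(4y)} dy over y > 0. Since r_ij² and ν_ij are averages,
y^{ν_ij-1} e^{-r_ij² y} is y⁻¹ times a product of an i-factor and a j-factor, and ρ_ij cancels what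
does not factor. So for each y the integrand is a Schur product of a rank-one matrix, β, and the
scalar kernel ψ^{-d/2} e^{-‖h‖²/(4yψ)} with ψ = ψ(u²).

That kernel is, up to a constant, the Fourier transform in v of e^{-yψ(u²)‖v‖²}
(`PositiveBernstein.posSemidef_gneiting`), so it remains to see that e^{-cψ(u²)} is positive
semidefinite. This is done without Bernstein's integral representation, by expanding -ψ in a Taylor
series whose non-constant terms are nonnegative multiples of Gaussians in u. -/

namespace GneitingMatern

open Filter Topology MeasureTheory
open scoped Matrix Nat

/-! ### Closure properties of positive semidefinite matrices -/

section PosSemidef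

variable {ι : Type*} [Fintype ι]

theorem posSemidef_real_iff {M : Matrix ι ι ℝ} :
    M.PosSemidef ↔ (∀ i j, M i j = M j i) ∧ ∀ x : ι → ℝ, 0 ≤ ∑ i, ∑ j, x i * M i j * x j := by
  rw [Matrix.posSemidef_iff_dotProduct_mulVec]
  refine and_congr ?_ (forall_congr' fun x => ?_)
  · rw [Matrix.IsHermitian.ext_iff]
    exact ⟨fun h i j => by simpa using h j i, fun h i j => by simpa using h j i⟩
  · simp [dotProduct, Matrix.mulVec, Finset.mul_sum, mul_assoc]

theorem posSemidef_of_tendsto {α : Type*} {l : Filter α} [l.NeBot] {A : α → Matrix ι ι ℝ}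
    {M : Matrix ι ι ℝ} (hA : ∀ᶠ n in l, (A n).PosSemidef)
    (h : ∀ i j, Tendsto (fun n => A n i j) l (𝓝 (M i j))) : M.PosSemidef := by
  rw [posSemidef_real_iff]
  constructor
  · intro i j
    refine tendsto_nhds_unique (h i j) ((h j i).congr' ?_)
    filter_upwards [hA] with n hn using (posSemidef_real_iff.1 hn).1 j i
  · intro x
    refine ge_of_tendsto (tendsto_finsetSum _ fun i _ => tendsto_finsetSum _ fun j _ =>
      ((h i j).const_mul (x i)).mul_const (x j)) ?_
    filter_upwards [hA] with n hn using (posSemidef_real_iff.1 hn).2 x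

theorem posSemidef_integral {Ω : Type*} [MeasurableSpace Ω] {μ : Measure Ω}
    {A : Ω → Matrix ι ι ℝ} (hA : ∀ᵐ v ∂μ, (A v).PosSemidef)
    (hint : ∀ i j, Integrable (fun v => A v i j) μ) :
    (Matrix.of fun i j => ∫ v, A v i j ∂μ).PosSemidef := by
  rw [posSemidef_real_iff]
  constructor
  · intro i j
    refine integral_congr_ae ?_
    filter_upwards [hA] with v hv using (posSemidef_real_iff.1 hv).1 i j
  · intro x
    have : ∑ i, ∑ j, x i * (Matrix.of fun i j => ∫ v, A v i j ∂μ) i j * x j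
        = ∫ v, ∑ i, ∑ j, x i * A v i j * x j ∂μ := by
      rw [integral_finsetSum _ fun i _ => integrable_finsetSum _ fun j _ =>
        ((hint i j).const_mul (x i)).mul_const (x j)]
      refine Finset.sum_congr rfl fun i _ => ?_
      rw [integral_finsetSum _ fun j _ => ((hint i j).const_mul (x i)).mul_const (x j)]
      refine Finset.sum_congr rfl fun j _ => ?_
      rw [integral_mul_const, integral_const_mul, Matrix.of_apply]
    rw [this]
    refine integral_nonneg_of_ae ?_
    filter_upwards [hA] with v hv using (posSemidef_real_iff.1 hv).2 x

theorem posSemidef_mul_self (a : ι → ℝ) : (Matrix.of fun i j => a i * a j).PosSemidef := by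
  simpa [Matrix.vecMulVec] using Matrix.posSemidef_vecMulVec_self_star a

theorem PosSemidef.entrywise_pow {M : Matrix ι ι ℝ} (hM : M.PosSemidef) (k : ℕ) :
    (Matrix.of fun i j => M i j ^ k).PosSemidef := by
  induction k with
  | zero => simpa using posSemidef_mul_self (fun _ : ι => (1 : ℝ))
  | succ k ih => simpa [Matrix.hadamard, pow_succ] using ih.hadamard hM

theorem PosSemidef.entrywise_exp {M : Matrix ι ι ℝ} (hM : M.PosSemidef) :
    (Matrix.of fun i j => Real.exp (M i j)).PosSemidef := by
  refine posSemidef_of_tendsto (l := atTop)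
    (A := fun n => ∑ k ∈ Finset.range n, ((k ! : ℝ)⁻¹) • Matrix.of fun i j => M i j ^ k)
    (.of_forall fun n => Matrix.posSemidef_sum _ fun k _ =>
      (PosSemidef.entrywise_pow hM k).smul (by positivity)) fun i j => ?_
  have := (NormedSpace.expSeries_div_hasSum_exp (M i j)).tendsto_sum_nat
  rw [← Real.exp_eq_exp_ℝ] at this
  simpa [Matrix.sum_apply, div_eq_inv_mul] using this

/-- Expanding the square leaves a rank-one factor times the entrywise exponential of 2c t_i t_j. -/
theorem posSemidef_gaussian (t : ι → ℝ) {c : ℝ} (hc : 0 ≤ c) :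
    (Matrix.of fun i j => Real.exp (-(c * (t i - t j) ^ 2))).PosSemidef := by
  have h := (posSemidef_mul_self fun i => Real.exp (-(c * t i ^ 2))).hadamard
    (PosSemidef.entrywise_exp ((posSemidef_mul_self t).smul (show 0 ≤ 2 * c by positivity)))
  convert! h using 1
  ext i j
  simp only [Matrix.of_apply, Matrix.hadamard_apply, Matrix.smul_apply, smul_eq_mul,
    ← Real.exp_add]
  ring_nf

theorem posSemidef_cos {E : Type*} [NormedAddCommGroup E] [InnerProductSpace ℝ E]
    (s : ι → E) (v : E) : (Matrix.of fun i j => Real.cos (inner ℝ (s i - s j) v)).PosSemidef := by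
  convert! (posSemidef_mul_self fun i => Real.cos (inner ℝ (s i) v)).add
    (posSemidef_mul_self fun i => Real.sin (inner ℝ (s i) v)) using 1
  ext i j
  simp [inner_sub_left, Real.cos_sub]

end PosSemidef

/-! ### Bernstein functions and Schoenberg-type kernels -/

section Bernstein

/-- To the left of S every Taylor term of order at least 1 and every integral remainder is
nonnegative. The remainder at a point a < x is therefore at most f(a) - f(S), and the one at x is
smaller by a geometric factor. -/
theorem taylor_tendsto_of_alternating {f : ℝ → ℝ} (hf : ContDiffOn ℝ ∞ f (Set.Ioi 0))
    (hs : ∀ (n : ℕ) (t : ℝ), 0 < t → 0 ≤ (-1 : ℝ) ^ (n + 1) * iteratedDeriv (n + 1) f t)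
    {x S : ℝ} (hx : 0 < x) (hxS : x < S) :
    Tendsto (fun n : ℕ => ∑ k ∈ Finset.range (n + 1),
      iteratedDeriv k f S / k ! * (x - S) ^ k) atTop (𝓝 (f x)) := by
  set P : ℕ → ℝ → ℝ := fun n y => ∑ k ∈ Finset.range (n + 1),
      iteratedDeriv k f S / k ! * (y - S) ^ k with hP
  have hwithin : ∀ y, 0 < y → y < S → ∀ k, ∀ t ∈ Set.Icc y S,
      iteratedDerivWithin k f (Set.Icc y S) t = iteratedDeriv k f t := by
    intro y hy hyS k t ht
    refine iteratedDerivWithin_eq_iteratedDeriv (uniqueDiffOn_Icc hyS) ?_ ht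
    exact (hf.contDiffAt (Ioi_mem_nhds (hy.trans_le ht.1))).of_le (mod_cast le_top)
  have hcd : ∀ y, 0 < y → ∀ n : ℕ, ContDiffOn ℝ n f (Set.Icc y S) := fun y hy n =>
    (hf.mono fun t ht => hy.trans_le ht.1).of_le (mod_cast le_top)
  have hcont : ∀ y, 0 < y → y < S → ∀ n : ℕ, ContinuousOn (iteratedDeriv n f) (Set.Icc y S) := by
    intro y hy hyS n
    exact ((hcd y hy n).continuousOn_iteratedDerivWithin le_rfl (uniqueDiffOn_Icc hyS)).congr
      fun t ht => (hwithin y hy hyS n t ht).symm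
  have hrem : ∀ y, 0 < y → y < S → ∀ n : ℕ, f y - P n y =
      ∫ t in y..S, (t - y) ^ n / n ! * ((-1) ^ (n + 1) * iteratedDeriv (n + 1) f t) := by
    intro y hy hyS n
    have h := taylor_integral_remainder (f := f) (x := y) (x₀ := S) (n := n)
      (by rw [Set.uIcc_of_ge hyS.le]; exact hcd y hy _)
    rw [Set.uIcc_of_ge hyS.le, taylor_within_apply] at h
    have hPy : P n y = ∑ k ∈ Finset.range (n + 1),
        ((k ! : ℝ)⁻¹ * (y - S) ^ k) • iteratedDerivWithin k f (Set.Icc y S) S := by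
      refine Finset.sum_congr rfl fun k _ => ?_
      rw [hwithin y hy hyS k S (Set.right_mem_Icc.2 hyS.le), smul_eq_mul]
      ring
    rw [hPy, h, intervalIntegral.integral_symm, ← intervalIntegral.integral_neg]
    refine intervalIntegral.integral_congr fun t ht => ?_
    rw [Set.uIcc_of_le hyS.le] at ht
    simp only [hwithin y hy hyS (n + 1) t ht, smul_eq_mul]
    rw [show y - t = (-1) * (t - y) by ring, mul_pow]
    ring
  have hPge : ∀ y, 0 < y → y < S → ∀ n, f S ≤ P n y := by
    intro y hy hyS n
    rw [hP]
    simp only [Finset.sum_range_succ']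
    have : 0 ≤ ∑ k ∈ Finset.range n,
        iteratedDeriv (k + 1) f S / (k + 1)! * (y - S) ^ (k + 1) := by
      refine Finset.sum_nonneg fun k _ => ?_
      have h := hs k S (hy.trans hyS)
      rw [show y - S = (-1) * (S - y) by ring, mul_pow]
      have h2 : 0 ≤ S - y := by linarith
      have : iteratedDeriv (k + 1) f S / (k + 1)! * ((-1) ^ (k + 1) * (S - y) ^ (k + 1)) =
        ((-1) ^ (k + 1) * iteratedDeriv (k + 1) f S) * (S - y) ^ (k + 1) / (k + 1)! := by ring
      rw [this]
      positivity
    simp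
    linarith
  -- Any point of (0, x) would serve as the comparison point.
  set a := x / 2
  have ha : 0 < a := by positivity
  have hax : a < x := half_lt_self hx
  have haS := hax.trans hxS
  set q := (S - x) / (S - a)
  have hq0 : 0 ≤ q := div_nonneg (by linarith) (by linarith)
  have hq1 : q < 1 := (div_lt_one (by linarith)).2 (by linarith)
  have hii : ∀ y, 0 < y → y < S → ∀ z n, IntervalIntegrable (fun t => (t - z) ^ n / n ! *
      ((-1) ^ (n + 1) * iteratedDeriv (n + 1) f t)) volume y S := by
    intro y hy hyS z n
    refine ContinuousOn.intervalIntegrable ?_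
    rw [Set.uIcc_of_le hyS.le]
    have := hcont y hy hyS (n + 1)
    fun_prop
  have hnn : ∀ n, 0 ≤ f x - P n x := by
    intro n
    rw [hrem x hx hxS n]
    refine intervalIntegral.integral_nonneg hxS.le fun t ht => ?_
    have := hs n t (hx.trans_le ht.1)
    have : 0 ≤ t - x := by linarith [ht.1]
    positivity
  have hle : ∀ n, f x - P n x ≤ q ^ n * (f a - f S) := by
    intro n
    calc f x - P n x ≤ ∫ t in x..S, q ^ n * ((t - a) ^ n / n ! *
          ((-1) ^ (n + 1) * iteratedDeriv (n + 1) f t)) := by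
          rw [hrem x hx hxS n]
          refine intervalIntegral.integral_mono_on hxS.le (hii x hx hxS x n)
            ((hii x hx hxS a n).const_mul _) fun t ht => ?_
          have h1 := hs n t (hx.trans_le ht.1)
          have h2 : 0 ≤ t - x := by linarith [ht.1]
          -- The ratio (t - x)/(t - a) increases in t and equals q at t = S.
          have h3 : t - x ≤ q * (t - a) := by
            rw [div_mul_eq_mul_div, le_div_iff₀ (by linarith)]
            nlinarith [ht.2]
          calc _ ≤ (q * (t - a)) ^ n / n ! * ((-1) ^ (n + 1) * iteratedDeriv (n + 1) f t) := by
                gcongr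
            _ = _ := by rw [mul_pow]; ring
      _ = q ^ n * ∫ t in x..S, (t - a) ^ n / n ! *
          ((-1) ^ (n + 1) * iteratedDeriv (n + 1) f t) :=
          intervalIntegral.integral_const_mul _ _
      _ ≤ q ^ n * ∫ t in a..S, (t - a) ^ n / n ! *
          ((-1) ^ (n + 1) * iteratedDeriv (n + 1) f t) := by
          gcongr
          refine intervalIntegral.integral_mono_interval hax.le hxS.le le_rfl ?_ (hii a ha haS a n)
          rw [EventuallyLE, ae_restrict_iff' measurableSet_Ioc]
          refine .of_forall fun t ht => ?_
          have h1 := hs n t (ha.trans ht.1)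
          have h2 : 0 ≤ t - a := by linarith [ht.1]
          simp only [Pi.zero_apply]
          positivity
      _ = q ^ n * (f a - P n a) := by rw [hrem a ha haS n]
      _ ≤ _ := by
          have := hPge a ha haS n
          gcongr
  have hlim : Tendsto (fun n => q ^ n * (f a - f S)) atTop (𝓝 0) := by
    simpa using (tendsto_pow_atTop_nhds_zero_of_lt_one hq0 hq1).mul_const (f a - f S)
  have := (squeeze_zero hnn hle hlim).const_sub (f x)
  simpa using this

theorem PositiveBernstein.contDiffOn {ψ : ℝ → ℝ} (hψ : PositiveBernstein ψ) :
    ContDiffOn ℝ ∞ ψ (Set.Ioi 0) :=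
  (contDiffOn_infty_iff_deriv_of_isOpen isOpen_Ioi).2
    ⟨hψ.differentiableOn, hψ.deriv_completelyMonotone.contDiffOn⟩

/-- The argument u = (t_i - t_j)² is replaced by ε + T(1 - e^{-u/T}). About S = ε + T the Taylor
powers are (-T)^k e^{-ku/T}, Gaussian kernels whose sign is absorbed by the derivatives of -ψ. Then
T → ∞ and ε → 0. -/
theorem PositiveBernstein.posSemidef_exp_neg {ι : Type*} [Fintype ι] {ψ : ℝ → ℝ}
    (hψ : PositiveBernstein ψ) (t : ι → ℝ) {c : ℝ} (hc : 0 ≤ c) :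
    (Matrix.of fun i j => Real.exp (-(c * ψ ((t i - t j) ^ 2)))).PosSemidef := by
  have hsign : ∀ (n : ℕ) (u : ℝ), 0 < u →
      (-1 : ℝ) ^ (n + 1) * iteratedDeriv (n + 1) ψ u ≤ 0 := by
    intro n u hu
    have := hψ.deriv_completelyMonotone.alternating n u hu
    rw [← iteratedDeriv_succ'] at this
    rw [pow_succ]
    linarith
  have hnegiter : ∀ n u, iteratedDeriv n (fun s => -ψ s) u = -iteratedDeriv n ψ u :=
    fun n u => iteratedDeriv_fun_neg n ψ u
  have key : ∀ ε T : ℝ, 0 < ε → 0 < T → (Matrix.of fun i j => Real.exp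
      (-(c * ψ (ε + T * (1 - Real.exp (-((t i - t j) ^ 2 / T))))))).PosSemidef := by
    intro ε T hε hT
    have hS : 0 < ε + T := by positivity
    -- The constant term -cψ(S) has the wrong sign for a kernel, so it is split off as the positive
    -- scalar e^{-cψ(S)}.
    refine posSemidef_of_tendsto (l := atTop) (A := fun n : ℕ =>
      Real.exp (-(c * ψ (ε + T))) • Matrix.of fun i j => Real.exp
        ((∑ k ∈ Finset.range n,
          (c * (-((-1) ^ (k + 1) * iteratedDeriv (k + 1) ψ (ε + T)) / (k + 1)! * T ^ (k + 1))) •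
          (Matrix.of fun i j => Real.exp (-((((k + 1 : ℕ) : ℝ) / T) * (t i - t j) ^ 2)))) i j))
      (.of_forall fun n => ?_) fun i j => ?_
    · refine (PosSemidef.entrywise_exp (Matrix.posSemidef_sum _ fun k _ =>
        (posSemidef_gaussian t (by positivity)).smul ?_)).smul (Real.exp_pos _).le
      have := neg_nonneg.2 (hsign k _ hS)
      positivity
    · set u := (t i - t j) ^ 2 with hu
      have hu0 : 0 ≤ u := sq_nonneg _
      have he : Real.exp (-(u / T)) ≤ 1 := Real.exp_le_one_iff.2 (neg_nonpos.2 (by positivity))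
      have hx : 0 < ε + T * (1 - Real.exp (-(u / T))) := by
        have := mul_nonneg hT.le (sub_nonneg.2 he)
        linarith
      have hxS : ε + T * (1 - Real.exp (-(u / T))) < ε + T := by
        have := mul_pos hT (Real.exp_pos (-(u / T)))
        linarith
      have h := taylor_tendsto_of_alternating (f := fun s => -ψ s) hψ.contDiffOn.neg
        (fun n s hs => by rw [hnegiter]; linarith [hsign n s hs]) hx hxS
      have h2 := (Real.continuous_exp.tendsto _).comp (h.const_mul c)
      simp only [mul_neg] at h2
      refine h2.congr fun n => ?_
      simp only [Function.comp_apply, Matrix.smul_apply, Matrix.of_apply, smul_eq_mul,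
        Matrix.sum_apply, ← Real.exp_add, Finset.sum_range_succ' _ n, hnegiter]
      congr 1
      rw [mul_add, add_comm, Finset.mul_sum]
      congr 1
      · simp
      · refine Finset.sum_congr rfl fun k _ => ?_
        have h3 : Real.exp (-(((k + 1 : ℕ) : ℝ) / T * u)) = Real.exp (-(u / T)) ^ (k + 1) := by
          rw [← Real.exp_nat_mul]
          congr 1
          ring
        rw [h3, show ε + T * (1 - Real.exp (-(u / T))) - (ε + T)
          = (-1) * T * Real.exp (-(u / T)) by ring, mul_pow, mul_pow]
        ring
  have hTlim : ∀ ε : ℝ, 0 < ε → (Matrix.of fun i j => Real.exp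
      (-(c * ψ (ε + (t i - t j) ^ 2)))).PosSemidef := by
    intro ε hε
    refine posSemidef_of_tendsto (l := atTop) (A := fun T : ℝ => Matrix.of fun i j => Real.exp
      (-(c * ψ (ε + T * (1 - Real.exp (-((t i - t j) ^ 2 / T)))))))
      ((eventually_gt_atTop 0).mono fun T hT => key ε T hε hT) fun i j => ?_
    set u := (t i - t j) ^ 2
    have hu0 : 0 ≤ u := sq_nonneg _
    have hcont : ContinuousAt ψ (ε + u) :=
      hψ.contDiffOn.continuousOn.continuousAt (Ioi_mem_nhds (by positivity))
    have hl : Tendsto (fun T : ℝ => ε + T * (1 - Real.exp (-(u / T)))) atTop (𝓝 (ε + u)) := by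
      -- With y = 1/T, the limit of T(1 - e^{-u/T}) is this derivative at 0.
      have hd : HasDerivAt (fun y : ℝ => 1 - Real.exp (-(u * y))) u 0 := by
        have := (((hasDerivAt_id (0 : ℝ)).const_mul u).neg.exp).const_sub 1
        simpa using this
      have h1 := hd.tendsto_slope_zero_right.comp tendsto_inv_atTop_nhdsGT_zero
      refine (h1.const_add ε).congr fun T => ?_
      simp [div_eq_mul_inv]
    exact (Real.continuous_exp.tendsto _).comp ((hcont.tendsto.comp hl).const_mul c).neg
  refine posSemidef_of_tendsto (l := 𝓝[>] (0 : ℝ)) (A := fun ε : ℝ => Matrix.of fun i j =>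
    Real.exp (-(c * ψ (ε + (t i - t j) ^ 2))))
    (eventually_mem_nhdsWithin.mono fun ε hε => hTlim ε hε) fun i j => ?_
  set u := (t i - t j) ^ 2
  have hu0 : 0 ≤ u := sq_nonneg _
  -- On the diagonal u = 0, where ψ is only continuous from the right.
  have hl : Tendsto (fun ε : ℝ => ε + u) (𝓝[>] 0) (𝓝[Set.Ici 0] u) := by
    refine tendsto_nhdsWithin_iff.2 ⟨?_, eventually_mem_nhdsWithin.mono fun ε hε => ?_⟩
    · have : Tendsto (fun ε : ℝ => ε + u) (𝓝 0) (𝓝 (0 + u)) := by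
        exact (continuous_id.add continuous_const).tendsto 0
      rw [zero_add] at this
      exact this.mono_left nhdsWithin_le_nhds
    · exact add_nonneg (le_of_lt hε) hu0
  have hcont : Tendsto ψ (𝓝[Set.Ici 0] u) (𝓝 (ψ u)) := hψ.continuousOn u hu0
  exact (Real.continuous_exp.tendsto _).comp ((hcont.comp hl).const_mul c).neg

end Bernstein

/-! ### The scalar Gneiting kernel by Gaussian Fourier transform -/

section Gneiting

variable {d : ℕ}

theorem integrable_exp_neg_mul_sq_norm_mul_cos {b : ℝ} (hb : 0 < b)
    (w : EuclideanSpace ℝ (Fin d)) :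
    Integrable fun v : EuclideanSpace ℝ (Fin d) =>
      Real.exp (-b * ‖v‖ ^ 2) * Real.cos (inner ℝ w v) := by
  have h := (GaussianFourier.integrable_cexp_neg_mul_sq_norm_add (b := (b : ℂ))
    (by simpa using hb) Complex.I w).re
  refine h.congr (.of_forall fun v => ?_)
  have : (-(b : ℂ) * (‖v‖ : ℂ) ^ 2 + Complex.I * (inner ℝ w v : ℝ)) =
    ((-b * ‖v‖ ^ 2 : ℝ) : ℂ) + (inner ℝ w v : ℝ) * Complex.I := by push_cast; ring
  simp only [this, RCLike.re_to_complex, Complex.exp_add, ← Complex.ofReal_exp, Complex.re_ofReal_mul,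
    Complex.exp_ofReal_mul_I_re]

theorem integral_exp_neg_mul_sq_norm_mul_cos {b : ℝ} (hb : 0 < b)
    (w : EuclideanSpace ℝ (Fin d)) :
    ∫ v : EuclideanSpace ℝ (Fin d), Real.exp (-b * ‖v‖ ^ 2) * Real.cos (inner ℝ w v) =
      (Real.pi / b) ^ ((d : ℝ) / 2) * Real.exp (-(‖w‖ ^ 2 / (4 * b))) := by
  have hb' : 0 < (b : ℂ).re := by simpa using hb
  have h := congrArg Complex.re
    (GaussianFourier.integral_cexp_neg_mul_sq_norm_add hb' Complex.I w)
  rw [← RCLike.re_to_complex, ← integral_re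
    (GaussianFourier.integrable_cexp_neg_mul_sq_norm_add hb' Complex.I w)] at h
  convert! h using 1
  · refine integral_congr_ae (.of_forall fun v => ?_)
    have : (-(b : ℂ) * (‖v‖ : ℂ) ^ 2 + Complex.I * (inner ℝ w v : ℝ)) =
      ((-b * ‖v‖ ^ 2 : ℝ) : ℂ) + (inner ℝ w v : ℝ) * Complex.I := by push_cast; ring
    simp only [this, RCLike.re_to_complex, Complex.exp_add, ← Complex.ofReal_exp,
      Complex.re_ofReal_mul, Complex.exp_ofReal_mul_I_re]
  · have h1 : ((Real.pi : ℂ) / b) ^ ((Module.finrank ℝ (EuclideanSpace ℝ (Fin d)) : ℂ) / 2) =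
        (((Real.pi / b) ^ ((d : ℝ) / 2) : ℝ) : ℂ) := by
      rw [Complex.ofReal_cpow (by positivity)]
      simp
    have h2 : Complex.I ^ 2 * (‖w‖ : ℂ) ^ 2 / (4 * b) = ((-(‖w‖ ^ 2 / (4 * b)) : ℝ) : ℂ) := by
      push_cast
      rw [Complex.I_sq]
      ring
    rw [h1, h2, ← Complex.ofReal_exp, ← Complex.ofReal_mul, Complex.ofReal_re]

theorem PositiveBernstein.posSemidef_gneiting {ι : Type*} [Fintype ι] {ψ : ℝ → ℝ}
    (hψ : PositiveBernstein ψ) (s : ι → EuclideanSpace ℝ (Fin d)) (t : ι → ℝ) {y : ℝ}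
    (hy : 0 < y) :
    (Matrix.of fun i j => (ψ ((t i - t j) ^ 2) ^ ((d : ℝ) / 2))⁻¹ *
      Real.exp (-(‖s i - s j‖ ^ 2 / (4 * (y * ψ ((t i - t j) ^ 2)))))).PosSemidef := by
  have hpos : ∀ i j, 0 < ψ ((t i - t j) ^ 2) := fun i j => hψ.pos _ (sq_nonneg _)
  have h : (Matrix.of fun i j => ∫ v : EuclideanSpace ℝ (Fin d),
      Real.exp (-(y * ψ ((t i - t j) ^ 2)) * ‖v‖ ^ 2) *
        Real.cos (inner ℝ (s i - s j) v)).PosSemidef := by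
    refine posSemidef_integral (A := fun v => Matrix.of fun i j =>
      Real.exp (-(y * ψ ((t i - t j) ^ 2)) * ‖v‖ ^ 2) * Real.cos (inner ℝ (s i - s j) v))
      (.of_forall fun v => ?_)
      fun i j => integrable_exp_neg_mul_sq_norm_mul_cos (mul_pos hy (hpos i j)) _
    convert! (hψ.posSemidef_exp_neg t (show 0 ≤ y * ‖v‖ ^ 2 by positivity)).hadamard
      (posSemidef_cos s v) using 1
    ext i j
    simp only [Matrix.of_apply, Matrix.hadamard_apply]
    ring_nf
  convert! h.smul (show 0 ≤ ((Real.pi / y) ^ ((d : ℝ) / 2))⁻¹ by positivity) using 1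
  ext i j
  have hp := hpos i j
  simp only [Matrix.of_apply, Matrix.smul_apply, smul_eq_mul,
    integral_exp_neg_mul_sq_norm_mul_cos (mul_pos hy hp)]
  rw [← div_div Real.pi, Real.div_rpow (by positivity) hp.le]
  have : (Real.pi / y) ^ ((d : ℝ) / 2) ≠ 0 := by positivity
  field_simp

end Gneiting

/-! ### The Matérn function as a Gaussian scale mixture -/

section Matern

theorem integrableOn_rpow_mul_exp_mul_exp {r ν : ℝ} (hr : 0 < r) (hν : 0 < ν) (a : ℝ) :
    IntegrableOn (fun y : ℝ => y ^ (ν - 1) * Real.exp (-(r ^ 2 * y)) *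
      Real.exp (-(a ^ 2 / (4 * y)))) (Set.Ioi 0) := by
  have h : IntegrableOn (fun y : ℝ => y ^ (ν - 1) * Real.exp (-(r ^ 2 * y))) (Set.Ioi 0) := by
    have := integrableOn_rpow_mul_exp_neg_mul_rpow (p := 1) (s := ν - 1) (b := r ^ 2)
      (by linarith) one_pos (by positivity)
    simpa using this
  refine Integrable.mono' h (by fun_prop) ?_
  rw [ae_restrict_iff' measurableSet_Ioi]
  refine .of_forall fun y (hy : 0 < y) => ?_
  rw [Real.norm_of_nonneg (by positivity)]
  refine mul_le_of_le_one_right (by positivity) (Real.exp_le_one_iff.2 ?_)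
  have : 0 ≤ a ^ 2 / (4 * y) := by positivity
  linarith

/-- Substituting y = κe^t with κ = a/(2r) balances the exponents: r²y + a²/(4y) = ra cosh t. Folding
t to -t turns e^{νt} into 2 cosh(νt). -/
theorem integral_eq_besselK {r ν a : ℝ} (hr : 0 < r) (hν : 0 < ν) (ha : 0 < a) :
    ∫ y in Set.Ioi (0 : ℝ), y ^ (ν - 1) * Real.exp (-(r ^ 2 * y)) *
      Real.exp (-(a ^ 2 / (4 * y))) = (a / (2 * r)) ^ ν * (2 * besselK ν (r * a)) := by
  set κ := a / (2 * r) with hκ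
  have hκ0 : 0 < κ := by positivity
  set g : ℝ → ℝ := fun y => y ^ (ν - 1) * Real.exp (-(r ^ 2 * y)) *
      Real.exp (-(a ^ 2 / (4 * y))) with hg
  set G : ℝ → ℝ := fun t => κ ^ ν * (Real.exp (-(r * a) * Real.cosh t) * Real.exp (ν * t)) with hG
  have himage : (fun t => κ * Real.exp t) '' Set.univ = Set.Ioi 0 := by
    ext y
    simp only [Set.image_univ, Set.mem_range, Set.mem_Ioi]
    constructor
    · rintro ⟨t, rfl⟩
      positivity
    · intro hy
      refine ⟨Real.log (y / κ), ?_⟩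
      rw [Real.exp_log (by positivity)]
      field_simp
  have hderiv : ∀ t ∈ Set.univ, HasDerivWithinAt (fun t => κ * Real.exp t) (κ * Real.exp t)
      Set.univ t := fun t _ => ((Real.hasDerivAt_exp t).const_mul κ).hasDerivWithinAt
  have hinj : Set.InjOn (fun t => κ * Real.exp t) Set.univ := fun s _ t _ h =>
    Real.exp_injective (mul_left_cancel₀ hκ0.ne' h)
  have hpt : (fun t => |κ * Real.exp t| • g (κ * Real.exp t)) = G := by
    funext t
    have he : 0 < κ * Real.exp t := by positivity
    have h1 : (κ * Real.exp t) * (κ * Real.exp t) ^ (ν - 1) = κ ^ ν * Real.exp (ν * t) := by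
      rw [Real.rpow_sub_one he.ne', mul_div_cancel₀ _ he.ne',
        Real.mul_rpow hκ0.le (Real.exp_pos t).le, ← Real.exp_mul, mul_comm t]
    have h2 : -(r ^ 2 * (κ * Real.exp t)) + -(a ^ 2 / (4 * (κ * Real.exp t))) =
        -(r * a) * Real.cosh t := by
      rw [Real.cosh_eq, Real.exp_neg, hκ]
      field_simp
      ring
    simp only [hg, hG, smul_eq_mul, abs_of_pos he]
    rw [mul_assoc (_ ^ _), ← Real.exp_add, h2, ← mul_assoc, h1]
    ring
  have hGint : Integrable G := by
    rw [← hpt, ← integrableOn_univ,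
      ← integrableOn_image_iff_integrableOn_abs_deriv_smul MeasurableSet.univ hderiv hinj, himage]
    exact integrableOn_rpow_mul_exp_mul_exp hr hν a
  have hGint' : Integrable fun t => G (-t) := hGint.comp_neg
  calc ∫ y in Set.Ioi (0 : ℝ), g y = ∫ t, G t := by
        rw [← himage, integral_image_eq_integral_abs_deriv_smul MeasurableSet.univ hderiv hinj,
          hpt, setIntegral_univ]
    _ = (∫ t in Set.Ioi (0 : ℝ), G (-t)) + ∫ t in Set.Ioi (0 : ℝ), G t := by
        rw [← intervalIntegral.integral_Iic_add_Ioi (b := 0) hGint.integrableOn hGint.integrableOn,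
          integral_comp_neg_Ioi, neg_zero]
    _ = ∫ t in Set.Ioi (0 : ℝ), (κ ^ ν * 2) *
          (Real.exp (-(r * a) * Real.cosh t) * Real.cosh (ν * t)) := by
        rw [← integral_add hGint'.integrableOn hGint.integrableOn]
        refine setIntegral_congr_fun measurableSet_Ioi fun t _ => ?_
        simp only [hG, Real.cosh_neg, Real.cosh_eq (ν * t), mul_neg]
        ring
    _ = _ := by rw [integral_const_mul, besselK, mul_assoc]

theorem Gamma_mul_matern {d : ℕ} (h : EuclideanSpace ℝ (Fin d)) {r ν : ℝ} (hr : 0 < r)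
    (hν : 0 < ν) :
    Real.Gamma ν * matern h r ν = r ^ (2 * ν) * ∫ y in Set.Ioi (0 : ℝ),
      y ^ (ν - 1) * Real.exp (-(r ^ 2 * y)) * Real.exp (-(‖h‖ ^ 2 / (4 * y))) := by
  have hΓ := Real.Gamma_pos_of_pos hν
  have hr2 : r ^ (2 * ν) = (r ^ 2) ^ ν := by
    rw [Real.rpow_mul hr.le, Real.rpow_ofNat]
  by_cases h0 : h = 0
  · subst h0
    have := Real.integral_rpow_mul_exp_neg_mul_Ioi hν (show 0 < r ^ 2 by positivity)
    simp only [matern, if_true, norm_zero, ne_eq, OfNat.ofNat_ne_zero, not_false_eq_true, zero_pow,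
      zero_div, neg_zero, Real.exp_zero, mul_one, this]
    rw [hr2, ← mul_assoc, ← Real.mul_rpow (by positivity) (by positivity),
      mul_one_div_cancel (by positivity), Real.one_rpow, one_mul]
  · have ha : 0 < ‖h‖ := norm_pos_iff.2 h0
    rw [integral_eq_besselK hr hν ha, matern, if_neg h0, hr2]
    have h1 : (r ^ 2) ^ ν * (‖h‖ / (2 * r)) ^ ν = (r * ‖h‖) ^ ν / 2 ^ ν := by
      rw [← Real.mul_rpow (by positivity) (by positivity),
        ← Real.div_rpow (by positivity) (by positivity)]
      congr 1
      field_simp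
    have h2 : (2 : ℝ) ^ (1 - ν) = 2 / 2 ^ ν := by
      rw [Real.rpow_sub two_pos, Real.rpow_one]
    rw [← mul_assoc (_ ^ ν) (_ ^ ν), h1, h2]
    field_simp

end Matern

/-! ### Assembly of the multivariate model -/

theorem gneitingMatern_apply_eq_integral {d p : ℕ} {ψ : ℝ → ℝ} {σ r₀ ν₀ : Fin p → ℝ}
    {β : Matrix (Fin p) (Fin p) ℝ} {r ν ρ : Fin p → Fin p → ℝ} {i j : Fin p}
    (hr : 0 < r i j) (hν : 0 < ν i j)
    (hρ : ρ i j = β i j * (Real.Gamma (ν i j) /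
        (Real.Gamma (ν₀ i) ^ (1 / 2 : ℝ) * Real.Gamma (ν₀ j) ^ (1 / 2 : ℝ))) *
        (r₀ i ^ ν₀ i * r₀ j ^ ν₀ j / r i j ^ (2 * ν i j)))
    (h : EuclideanSpace ℝ (Fin d)) (u : ℝ) :
    gneitingMatern ψ σ ρ r ν h u i j = ∫ y in Set.Ioi (0 : ℝ),
      (σ i * (r₀ i ^ ν₀ i / Real.Gamma (ν₀ i) ^ (1 / 2 : ℝ))) *
      (σ j * (r₀ j ^ ν₀ j / Real.Gamma (ν₀ j) ^ (1 / 2 : ℝ))) * β i j *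
      (ψ (u ^ 2) ^ ((d : ℝ) / 2))⁻¹ *
      (y ^ (ν i j - 1) * Real.exp (-(r i j ^ 2 * y)) *
        Real.exp (-(‖(ψ (u ^ 2) ^ (1 / 2 : ℝ))⁻¹ • h‖ ^ 2 / (4 * y)))) := by
  have hM := Gamma_mul_matern ((ψ (u ^ 2) ^ (1 / 2 : ℝ))⁻¹ • h) hr hν
  rw [mul_comm, ← eq_div_iff (Real.Gamma_pos_of_pos hν).ne'] at hM
  -- Γ(ν_ij) and r_ij^{2ν_ij} from the mixture cancel against ρ_ij.
  rw [integral_const_mul, gneitingMatern, Matrix.of_apply, hM, hρ]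
  have h1 := (Real.Gamma_pos_of_pos hν).ne'
  have h2 : r i j ^ (2 * ν i j) ≠ 0 := (Real.rpow_pos_of_pos hr _).ne'
  generalize (∫ y in Set.Ioi (0 : ℝ), y ^ (ν i j - 1) * Real.exp (-(r i j ^ 2 * y)) *
    Real.exp (-(‖(ψ (u ^ 2) ^ (1 / 2 : ℝ))⁻¹ • h‖ ^ 2 / (4 * y)))) = I
  field_simp

end GneitingMatern

open GneitingMatern MeasureTheory Filter in
theorem theorem1 (d p : ℕ) (ψ : ℝ → ℝ) (hψ : GneitingMatern.PositiveBernstein ψ)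
    (σ r₀ ν₀ : Fin p → ℝ) (hr₀ : ∀ i, 0 < r₀ i) (hν₀ : ∀ i, 0 < ν₀ i)
    (β : Matrix (Fin p) (Fin p) ℝ) (hβ : GneitingMatern.IsCorrelationMatrix β)
    (r ν ρ : Fin p → Fin p → ℝ)
    (hr : ∀ i j, r i j = ((r₀ i ^ 2 + r₀ j ^ 2) / 2) ^ (1 / 2 : ℝ))
    (hν : ∀ i j, ν i j = (ν₀ i + ν₀ j) / 2)
    (hρ : ∀ i j, ρ i j =
      β i j * (Real.Gamma (ν i j) /
        (Real.Gamma (ν₀ i) ^ (1 / 2 : ℝ) * Real.Gamma (ν₀ j) ^ (1 / 2 : ℝ))) *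
        (r₀ i ^ ν₀ i * r₀ j ^ ν₀ j / r i j ^ (2 * ν i j))) :
    GneitingMatern.IsValidCovariance (d := d) (GneitingMatern.gneitingMatern ψ σ ρ r ν) := by
  intro n s t
  have hpos : ∀ u : ℝ, 0 < ψ (u ^ 2) := fun u => hψ.pos _ (sq_nonneg u)
  have hrpos : ∀ i j, 0 < r i j := fun i j => by
    have := hr₀ i
    have := hr₀ j
    rw [hr]
    positivity
  have hνpos : ∀ i j, 0 < ν i j := fun i j => by
    have := hν₀ i
    have := hν₀ j
    rw [hν]
    positivity
  simp_rw [gneitingMatern_apply_eq_integral (hrpos _ _) (hνpos _ _) (hρ _ _)]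
  refine posSemidef_integral (μ := volume.restrict (Set.Ioi (0 : ℝ)))
    (A := fun y => Matrix.of fun a b : Fin n × Fin p =>
      (σ a.2 * (r₀ a.2 ^ ν₀ a.2 / Real.Gamma (ν₀ a.2) ^ (1 / 2 : ℝ))) *
      (σ b.2 * (r₀ b.2 ^ ν₀ b.2 / Real.Gamma (ν₀ b.2) ^ (1 / 2 : ℝ))) * β a.2 b.2 *
      (ψ ((t a.1 - t b.1) ^ 2) ^ ((d : ℝ) / 2))⁻¹ *
      (y ^ (ν a.2 b.2 - 1) * Real.exp (-(r a.2 b.2 ^ 2 * y)) * Real.exp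
        (-(‖(ψ ((t a.1 - t b.1) ^ 2) ^ (1 / 2 : ℝ))⁻¹ • (s a.1 - s b.1)‖ ^ 2 / (4 * y)))))
    ?_ fun a b => (integrableOn_rpow_mul_exp_mul_exp (hrpos _ _) (hνpos _ _) _).const_mul _
  rw [ae_restrict_iff' measurableSet_Ioi]
  refine .of_forall fun y (hy : 0 < y) => ?_
  -- Each index carries y^{ν_i/2} e^{-r_i² y/2}; the leftover y⁻¹ is a nonnegative scalar.
  convert! (((posSemidef_mul_self fun a : Fin n × Fin p =>
    σ a.2 * (r₀ a.2 ^ ν₀ a.2 / Real.Gamma (ν₀ a.2) ^ (1 / 2 : ℝ)) *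
      (y ^ (ν₀ a.2 / 2) * Real.exp (-(r₀ a.2 ^ 2 / 2 * y)))).hadamard
    (hβ.1.submatrix Prod.snd)).hadamard
    (hψ.posSemidef_gneiting (fun a => s a.1) (fun a => t a.1) hy)).smul
      (show 0 ≤ y⁻¹ by positivity) using 1
  ext a b
  have hψab := hpos (t a.1 - t b.1)
  have hnorm : ‖(ψ ((t a.1 - t b.1) ^ 2) ^ (1 / 2 : ℝ))⁻¹ • (s a.1 - s b.1)‖ ^ 2 / (4 * y) =
      ‖s a.1 - s b.1‖ ^ 2 / (4 * (y * ψ ((t a.1 - t b.1) ^ 2))) := by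
    rw [norm_smul, mul_pow, norm_inv, inv_pow, Real.norm_of_nonneg (by positivity),
      ← Real.sqrt_eq_rpow, Real.sq_sqrt hψab.le]
    field_simp
  have hpow : y ^ (ν a.2 b.2 - 1) = y⁻¹ * (y ^ (ν₀ a.2 / 2) * y ^ (ν₀ b.2 / 2)) := by
    rw [← Real.rpow_add hy, Real.rpow_sub_one hy.ne', hν, add_div, div_eq_inv_mul]
  have hexp : Real.exp (-(r a.2 b.2 ^ 2 * y)) =
      Real.exp (-(r₀ a.2 ^ 2 / 2 * y)) * Real.exp (-(r₀ b.2 ^ 2 / 2 * y)) := by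
    rw [← Real.exp_add, hr, ← Real.sqrt_eq_rpow, Real.sq_sqrt (by positivity)]
    ring_nf
  simp only [Matrix.of_apply, Matrix.hadamard_apply, Matrix.smul_apply, smul_eq_mul,
    Matrix.submatrix_apply, hnorm, hpow, hexp]
  ring
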